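/- \textbf{Theorem.} There is an absolute constant $\kappa>0$ such that for every real $\eta>0$ there is a real $c>0$ with the following property. Let $n\ge 2$ and $\ell$ be integers with $\ell\ge c\cdot\log_2 n$, and let $g:\{0,1\}^\ell\times\{0,1\}^\ell\to\{0,1\}$ be a function with $\mathrm{disc}(g)\le 2^{-\eta\ell}$. Then every function $f:\{0,1\}^n\to\{0,1\}$ satisfies \[ \mathsf{coNP^{cc}}(f\circ g^n)\ \ge\ \kappa\cdot\eta\cdot \mathsf{C}_0(f)\cdot \ell . \] Here the following notions are used. \begin{itemize} \item $(f\circ g^n)(x,y)=f(g(x_1,y_1),\dots,g(x_n,y_n))$ for $x,y\in\{0,1\}^{\ell n}$, viewed as concatenations of $n$ blocks $x_i,y_i\in\{0,1\}^\ell$. \item $\mathrm{disc}(g)$ is the maximum of $\big|\Pr[g(X,Y)=0,\,(X,Y)\in R]-\Pr[g(X,Y)=1,\,(X,Y)\in R]\big|$ over all combinatorial rectangles $R=A\times B$ with $A,B\subseteq\{0,1\}^\ell$, where $X,Y$ are independent and uniform on $\{0,1\}^\ell$. \item $\mathsf{C}_0(f)$ is the smallest $k$ such that the negation $\neg f$ can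 be written as a $k$-DNF formula, that is, as a (possibly empty) disjunction of conjunctions of at most $k$ literals each. \item A non-deterministic protocol is a finite binary tree, each internal node of which is owned by one of the two players. At an internal node its owner sends one bit, chosen non-deterministically from a set of bits that depends only on the node and on the owner's input; at a leaf each of the two players accepts or rejects, depending only on the leaf and on that player's input, and the computation is accepting if both accept. The cost is the depth of the tree. $\mathsf{coNP^{cc}}(F)$ is the smallest cost of a non-deterministic protocol that has an accepting computation on $(x,y)$ if and only if $F(x,y)=0$. (Equivalently, it is $\lceil\log_2 r\rceil$, where $r$ is the least number of combinatorial rectangles whose union is $F^{-1}(0)$, and it is $0$ if $r=0$.) \end{itemize} -/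

import Mathlib

namespace Lifting

/-! ### Non-deterministic communication complexity -/

/-- A two-player non-deterministic protocol, as a binary tree. At an internal node the owner
of the node sends one bit, chosen non-deterministically among the bits that are allowed by the
owner's own input. At a leaf each player accepts or rejects, depending on the player's own
input (and on the leaf, that is, on the bits exchanged so far). -/
inductive NProtocol (X Y : Type) : Type
  | leaf (acceptA : X → Prop) (acceptB : Y → Prop) : NProtocol X Y
  | alice (send : X → Set Bool) (next₀ next₁ : NProtocol X Y) : NProtocol X Y
  | bob (send : Y → Set Bool) (next₀ next₁ : NProtocol X Y) : NProtocol X Y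

namespace NProtocol

variable {X Y : Type}

/-- The worst-case number of communicated bits. -/
def cost : NProtocol X Y → ℕ
  | leaf _ _ => 0
  | alice _ P Q => max P.cost Q.cost + 1
  | bob _ P Q => max P.cost Q.cost + 1

/-- There is an accepting computation on the input `(x, y)`. -/
def Accepts : NProtocol X Y → X → Y → Prop
  | leaf a b, x, y => a x ∧ b y
  | alice s P Q, x, y => (false ∈ s x ∧ P.Accepts x y) ∨ (true ∈ s x ∧ Q.Accepts x y)
  | bob s P Q, x, y => (false ∈ s y ∧ P.Accepts x y) ∨ (true ∈ s y ∧ Q.Accepts x y)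

/-- The protocol is a non-deterministic protocol for `F`. -/
def Computes (P : NProtocol X Y) (F : X → Y → Bool) : Prop :=
  ∀ x y, F x y = true ↔ P.Accepts x y

end NProtocol

/-- Non-deterministic communication complexity: the smallest possible cost of a
non-deterministic protocol for `F`. -/
noncomputable def NPcc {X Y : Type} (F : X → Y → Bool) : ℕ :=
  sInf {t | ∃ P : NProtocol X Y, P.Computes F ∧ P.cost = t}

/-- Co-non-deterministic communication complexity: that of the negation of `F`. -/
noncomputable def coNPcc {X Y : Type} (F : X → Y → Bool) : ℕ :=
  NPcc (fun x y => !(F x y))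

/-! ### Composed functions -/

/-- The function `f ∘ g ^ n`. A vector of `n * ℓ` bits is given as `n` blocks of `ℓ` bits. -/
def compose {n ℓ : ℕ} (f : (Fin n → Bool) → Bool)
    (g : (Fin ℓ → Bool) → (Fin ℓ → Bool) → Bool) :
    (Fin n → Fin ℓ → Bool) → (Fin n → Fin ℓ → Bool) → Bool :=
  fun x y => f (fun i => g (x i) (y i))

/-! ### Certificate complexity -/

/-- A literal: `(i, true)` is the variable `x i` and `(i, false)` is its negation. -/
abbrev Literal (n : ℕ) : Type := Fin n × Bool

/-- A conjunction of literals (the empty one is identically true). -/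
abbrev Conj (n : ℕ) : Type := Finset (Literal n)

/-- The conjunction `C` is satisfied by the assignment `x`. -/
def Conj.Sat {n : ℕ} (C : Conj n) (x : Fin n → Bool) : Prop := ∀ p ∈ C, x p.1 = p.2

/-- A DNF formula: a disjunction of conjunctions (the empty one is identically false). -/
abbrev DNF (n : ℕ) : Type := List (Conj n)

/-- Every conjunction of the formula has at most `k` literals. -/
def DNF.IsKDNF {n : ℕ} (φ : DNF n) (k : ℕ) : Prop := ∀ C ∈ φ, C.card ≤ k

/-- The formula represents the Boolean function `f`. -/
def DNF.Represents {n : ℕ} (φ : DNF n) (f : (Fin n → Bool) → Bool) : Prop :=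
  ∀ x, f x = true ↔ ∃ C ∈ φ, Conj.Sat C x

/-- `1`-certificate complexity: the smallest `k` such that `f` is a `k`-DNF formula. -/
noncomputable def C₁ {n : ℕ} (f : (Fin n → Bool) → Bool) : ℕ :=
  sInf {k | ∃ φ : DNF n, DNF.IsKDNF φ k ∧ DNF.Represents φ f}

/-- `0`-certificate complexity: the `1`-certificate complexity of the negation. -/
noncomputable def C₀ {n : ℕ} (f : (Fin n → Bool) → Bool) : ℕ :=
  C₁ (fun x => !(f x))

/-! ### Discrepancy with respect to the uniform distribution -/

section Discrepancy

variable {Λ : Type} [Fintype Λ]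

open Classical in
/-- The probability of the event `E` for `(X, Y)` uniformly distributed over `Λ × Λ`. -/
noncomputable def prob (E : Set (Λ × Λ)) : ℝ :=
  ((Finset.univ.filter (fun p : Λ × Λ => p ∈ E)).card : ℝ) / (Fintype.card (Λ × Λ) : ℝ)

/-- The discrepancy of `g` on the combinatorial rectangle `A ×ˢ B`. -/
noncomputable def discOn (g : Λ → Λ → Bool) (A B : Finset Λ) : ℝ :=
  |prob {p : Λ × Λ | g p.1 p.2 = false ∧ p.1 ∈ A ∧ p.2 ∈ B} -
    prob {p : Λ × Λ | g p.1 p.2 = true ∧ p.1 ∈ A ∧ p.2 ∈ B}|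

/-- The discrepancy of `g`: the maximum over all combinatorial rectangles. -/
noncomputable def disc (g : Λ → Λ → Bool) : ℝ :=
  (Finset.univ : Finset (Finset Λ × Finset Λ)).sup' Finset.univ_nonempty
    (fun R => discOn g R.1 R.2)

end Discrepancy

end Lifting

/-!
Fix `z` with `f z = false`. If the zeros of `f ∘ g ^ n` are covered by `T` rectangles, one of them,
`A₀ × B₀`, contains a `1 / T` fraction of the preimage of `z` under `g ^ n`. Among the rectangles
`A × B ⊆ A₀ × B₀` on which all the blocks with index in a set `I` are constant, take one maximising
`hits ^ 2 * w ^ |I| / (|A| * |B|)`, where `hits` counts the pairs in `A × B` that are sent to `z`.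

Low discrepancy bounds the box norm of the sign matrix of `g`, hence the correlation of a rectangle
with a character in terms of the sizes of the fibers of `A` and `B`. So on the one hand
`hits` is small when `I` is large, which bounds `|I|` by `log T / (η * ℓ)` up to a constant. On the
other hand fixing further blocks cannot increase the score, so the fibers of `A` and `B` are small,
all the characters outside `I` are almost uncorrelated with `A × B`, and every `z'` agreeing with
`z` on `I` is attained on `A × B`. There `f` takes the value `false`, so `I` is a certificate.
-/

namespace Lifting

open Finset

section BoxSum

variable {X Y : Type*} [Fintype X] [Fintype Y]

/-- The sum over all `x, x', y, y'` of the product of `K` over `{x, x'} × {y, y'}`, which is the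
fourth power of the Gowers box norm of `K`. Unlike the discrepancy it is multiplicative under
tensor powers. -/
def boxSum (K : X → Y → ℝ) : ℝ := ∑ y, ∑ y', (∑ x, K x y * K x y') ^ 2

lemma boxSum_nonneg (K : X → Y → ℝ) : 0 ≤ boxSum K :=
  sum_nonneg fun _ _ => sum_nonneg fun _ _ => sq_nonneg _

lemma boxSum_eq_sum_mul_sum (K : X → Y → ℝ) :
    boxSum K = ∑ y', ∑ x', K x' y' * ∑ x, ∑ y, K x y' * K x' y * K x y := by
  rw [boxSum, sum_comm]
  refine sum_congr rfl fun y' _ => ?_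
  simp only [sq, sum_mul_sum]
  rw [sum_comm]
  simp only [mul_sum]
  calc ∑ x, ∑ y, ∑ x', K x y * K x y' * (K x' y * K x' y')
      = ∑ x, ∑ x', ∑ y, K x y * K x y' * (K x' y * K x' y') :=
        sum_congr rfl fun x _ => sum_comm
    _ = ∑ x', ∑ x, ∑ y, K x y * K x y' * (K x' y * K x' y') := sum_comm
    _ = _ := by
        refine sum_congr rfl fun x' _ => sum_congr rfl fun x _ => sum_congr rfl fun y _ => ?_
        ring

lemma sum_sq_sum_mul_eq (K : X → Y → ℝ) (v : Y → ℝ) :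
    ∑ x, (∑ y, v y * K x y) ^ 2 =
      ∑ p : Y × Y, (v p.1 * v p.2) * ∑ x, K x p.1 * K x p.2 := by
  simp only [sq, sum_mul_sum]
  simp only [Fintype.sum_prod_type, mul_sum]
  rw [sum_comm]
  refine sum_congr rfl fun y _ => ?_
  rw [sum_comm]
  exact sum_congr rfl fun y' _ => sum_congr rfl fun x _ => by ring

lemma sq_sum_sq_sum_mul_le (K : X → Y → ℝ) (v : Y → ℝ) :
    (∑ x, (∑ y, v y * K x y) ^ 2) ^ 2 ≤ (∑ y, v y ^ 2) ^ 2 * boxSum K := by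
  have hv : ∑ p : Y × Y, (v p.1 * v p.2) ^ 2 = (∑ y, v y ^ 2) ^ 2 := by
    simp only [mul_pow, Fintype.sum_prod_type, sq (∑ y, v y ^ 2), sum_mul_sum]
  have hK : ∑ p : Y × Y, (∑ x, K x p.1 * K x p.2) ^ 2 = boxSum K := by
    rw [boxSum, Fintype.sum_prod_type]
  rw [sum_sq_sum_mul_eq, ← hv, ← hK]
  exact sum_mul_sq_le_sq_mul_sq _ _ _

lemma bilinear_pow_four_le (K : X → Y → ℝ) (u : X → ℝ) (v : Y → ℝ) :
    (∑ x, ∑ y, u x * v y * K x y) ^ 4 ≤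
      (∑ x, u x ^ 2) ^ 2 * (∑ y, v y ^ 2) ^ 2 * boxSum K := by
  have hu : (∑ x, ∑ y, u x * v y * K x y) ^ 2 ≤
      (∑ x, u x ^ 2) * ∑ x, (∑ y, v y * K x y) ^ 2 := by
    simpa only [mul_sum, mul_assoc] using
      sum_mul_sq_le_sq_mul_sq univ u (fun x => ∑ y, v y * K x y)
  calc (∑ x, ∑ y, u x * v y * K x y) ^ 4 = ((∑ x, ∑ y, u x * v y * K x y) ^ 2) ^ 2 := by ring
    _ ≤ ((∑ x, u x ^ 2) * ∑ x, (∑ y, v y * K x y) ^ 2) ^ 2 := by gcongr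
    _ = (∑ x, u x ^ 2) ^ 2 * (∑ x, (∑ y, v y * K x y) ^ 2) ^ 2 := mul_pow _ _ _
    _ ≤ (∑ x, u x ^ 2) ^ 2 * ((∑ y, v y ^ 2) ^ 2 * boxSum K) := by
        gcongr
        exact sq_sum_sq_sum_mul_le K v
    _ = _ := (mul_assoc _ _ _).symm

lemma boxSum_tensor_pow {ι : Type*} [Fintype ι] [DecidableEq ι] (K : X → Y → ℝ) :
    boxSum (fun (x : ι → X) (y : ι → Y) => ∏ i, K (x i) (y i)) = boxSum K ^ Fintype.card ι := by
  have inner (y y' : ι → Y) : ∑ x : ι → X, (∏ i, K (x i) (y i)) * ∏ i, K (x i) (y' i) =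
      ∏ i, ∑ a, K a (y i) * K a (y' i) := by
    simp only [Fintype.prod_sum, prod_mul_distrib]
  have middle (y : ι → Y) : ∑ y' : ι → Y, ∏ i, (∑ a, K a (y i) * K a (y' i)) ^ 2 =
      ∏ i, ∑ c, (∑ a, K a (y i) * K a c) ^ 2 :=
    (Fintype.prod_sum fun i c => (∑ a, K a (y i) * K a c) ^ 2).symm
  have outer : ∑ y : ι → Y, ∏ i, ∑ c, (∑ a, K a (y i) * K a c) ^ 2 = ∏ _i : ι, boxSum K :=
    (Fintype.prod_sum fun _ b => ∑ c, (∑ a, K a b * K a c) ^ 2).symm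
  rw [boxSum]
  simp only [inner, ← prod_pow, middle]
  rw [outer, prod_const, card_univ]

end BoxSum

section Sign

variable {X Y : Type*}

/-- The sign `(-1) ^ b` of a bit, which turns parities into products. -/
def sgn (b : Bool) : ℝ := if b then -1 else 1

@[simp]
lemma abs_sgn (b : Bool) : |sgn b| = 1 := by cases b <;> simp [sgn]

lemma indicator_eq_sgn (b c : Bool) :
    (if b = c then (1 : ℝ) else 0) = (1 + sgn c * sgn b) / 2 := by
  cases b <;> cases c <;> norm_num [sgn]

lemma sum_sgn_mul [Fintype X] (u : X → Bool) (F : X → ℝ) :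
    ∑ x, sgn (u x) * F x = ∑ x with u x = false, F x - ∑ x with u x = true, F x := by
  rw [sum_filter, sum_filter, ← sum_sub_distrib]
  refine sum_congr rfl fun x _ => ?_
  cases h : u x <;> simp [sgn]

lemma abs_sum_sgn_mul_sgn_mul_le [Fintype X] [Fintype Y] {K : X → Y → ℝ} {c : ℝ}
    (hK : ∀ (A : Finset X) (B : Finset Y), |∑ x ∈ A, ∑ y ∈ B, K x y| ≤ c)
    (u : X → Bool) (v : Y → Bool) :
    |∑ x, ∑ y, sgn (u x) * sgn (v y) * K x y| ≤ 4 * c := by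
  have split : ∑ x, ∑ y, sgn (u x) * sgn (v y) * K x y =
      (∑ x with u x = false, ∑ y with v y = false, K x y -
        ∑ x with u x = false, ∑ y with v y = true, K x y) -
      (∑ x with u x = true, ∑ y with v y = false, K x y -
        ∑ x with u x = true, ∑ y with v y = true, K x y) := by
    simp only [mul_assoc, ← mul_sum, sum_sgn_mul, sum_sub_distrib]
  rw [split]
  refine (abs_sub _ _).trans ?_
  have bound (a b : Bool) := hK (univ.filter (u · = a)) (univ.filter (v · = b))
  calc _ ≤ (c + c) + (c + c) := add_le_add
        ((abs_sub _ _).trans (add_le_add (bound false false) (bound false true)))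
        ((abs_sub _ _).trans (add_le_add (bound true false) (bound true true)))
    _ = 4 * c := by ring

lemma boxSum_sgn_le [Fintype X] [Fintype Y] {g : X → Y → Bool} {c : ℝ}
    (hg : ∀ (A : Finset X) (B : Finset Y), |∑ x ∈ A, ∑ y ∈ B, sgn (g x y)| ≤ c) :
    boxSum (fun x y => sgn (g x y)) ≤ 4 * (Fintype.card X * Fintype.card Y) * c := by
  have term_le (x' : X) (y' : Y) :
      sgn (g x' y') * ∑ x, ∑ y, sgn (g x y') * sgn (g x' y) * sgn (g x y) ≤ 4 * c := by
    refine (le_abs_self _).trans ?_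
    rw [abs_mul, abs_sgn, one_mul]
    exact abs_sum_sgn_mul_sgn_mul_le hg (g · y') (g x' ·)
  rw [boxSum_eq_sum_mul_sum]
  calc _ ≤ ∑ _y' : Y, ∑ _x' : X, 4 * c := sum_le_sum fun y' _ => sum_le_sum fun x' _ =>
        term_le x' y'
    _ = _ := by
        simp only [sum_const, card_univ, nsmul_eq_mul]
        ring

end Sign

section Discrepancy

variable {Λ : Type} [Fintype Λ]

lemma discOn_le_disc (g : Λ → Λ → Bool) (A B : Finset Λ) : discOn g A B ≤ disc g :=
  le_sup' (fun R : Finset Λ × Finset Λ => discOn g R.1 R.2) (mem_univ (A, B))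

lemma abs_sum_sgn_eq_discOn (g : Λ → Λ → Bool) (A B : Finset Λ) :
    |∑ x ∈ A, ∑ y ∈ B, sgn (g x y)| = (Fintype.card Λ : ℝ) ^ 2 * discOn g A B := by
  classical
  rcases isEmpty_or_nonempty Λ with _ | _
  · simp [eq_empty_of_isEmpty A]
  rw [discOn, prob, prob, ← sub_div, abs_div, Fintype.card_prod, Nat.cast_mul, ← sq,
    abs_of_pos (by positivity : (0 : ℝ) < (Fintype.card Λ : ℝ) ^ 2),
    mul_div_cancel₀ _ (by positivity)]
  simp only [card_filter, Nat.cast_sum, Nat.cast_ite, Nat.cast_one, Nat.cast_zero,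
    Set.mem_ofPred_eq, ← sum_sub_distrib]
  congr 1
  rw [← sum_product', ← Fintype.sum_ite_mem]
  refine sum_congr rfl fun p _ => ?_
  simp only [mem_product]
  cases g p.1 p.2 <;> by_cases h : p.1 ∈ A ∧ p.2 ∈ B <;> simp [sgn, h]

lemma abs_sum_sgn_le (g : Λ → Λ → Bool) (A B : Finset Λ) :
    |∑ x ∈ A, ∑ y ∈ B, sgn (g x y)| ≤ (Fintype.card Λ : ℝ) ^ 2 * disc g := by
  rw [abs_sum_sgn_eq_discOn]
  gcongr
  exact discOn_le_disc g A B

lemma boxSum_sgn_le_disc (g : Λ → Λ → Bool) :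
    boxSum (fun x y => sgn (g x y)) ≤ 4 * (Fintype.card Λ : ℝ) ^ 4 * disc g :=
  (boxSum_sgn_le (abs_sum_sgn_le g)).trans_eq (by ring)

lemma le_sum_indicator_eq (g : Λ → Λ → Bool) (c : Bool) :
    (Fintype.card Λ : ℝ) ^ 2 / 2 * (1 - disc g) ≤
      ∑ a, ∑ b, (if g a b = c then (1 : ℝ) else 0) := by
  have bias := abs_sum_sgn_le g univ univ
  have hc : -(|∑ a, ∑ b, sgn (g a b)|) ≤ sgn c * ∑ a, ∑ b, sgn (g a b) := by
    simpa [abs_mul] using neg_abs_le (sgn c * ∑ a, ∑ b, sgn (g a b))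
  simp only [indicator_eq_sgn, ← sum_div, sum_add_distrib, ← mul_sum, sum_const, card_univ,
    nsmul_eq_mul, mul_one]
  linarith

end Discrepancy

section Fiber

variable {ι X : Type*} [DecidableEq X]

/-- The members of `A` whose restriction to the coordinates in `S` is `α`. -/
def fiber (A : Finset (ι → X)) (S : Finset ι) (α : S → X) : Finset (ι → X) :=
  A.filter fun x => S.restrict x = α

lemma fiber_subset (A : Finset (ι → X)) (S : Finset ι) (α : S → X) : fiber A S α ⊆ A :=
  filter_subset _ _

variable [Fintype X] [DecidableEq ι]

lemma sum_comp_restrict (A : Finset (ι → X)) (S : Finset ι) (F : (S → X) → ℝ) :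
    ∑ x ∈ A, F (S.restrict x) = ∑ α, #(fiber A S α) * F α := by
  rw [← sum_fiberwise' A S.restrict F]
  simp only [sum_const, nsmul_eq_mul, fiber]

lemma sum_card_fiber (A : Finset (ι → X)) (S : Finset ι) :
    ∑ α, (#(fiber A S α) : ℝ) = #A := by
  simpa using (sum_comp_restrict A S fun _ => 1).symm

lemma sum_card_fiber_sq_le (A : Finset (ι → X)) (S : Finset ι) {a : ℝ}
    (ha : ∀ α, (#(fiber A S α) : ℝ) ≤ a) : ∑ α, (#(fiber A S α) : ℝ) ^ 2 ≤ a * #A := by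
  rw [← sum_card_fiber A S, mul_sum]
  refine sum_le_sum fun α _ => ?_
  rw [sq]
  gcongr
  exact ha α

end Fiber

section Corr

variable {ι X Y : Type*}

/-- The correlation of the rectangle `A × B` with the tensor product of copies of `K` over the
coordinates in `S`. -/
def corr (K : X → Y → ℝ) (A : Finset (ι → X)) (B : Finset (ι → Y)) (S : Finset ι) : ℝ :=
  ∑ x ∈ A, ∑ y ∈ B, ∏ i ∈ S, K (x i) (y i)

variable [DecidableEq X] [DecidableEq Y] [Fintype X] [Fintype Y]

lemma corr_eq_sum_fiber [DecidableEq ι] (K : X → Y → ℝ) (A : Finset (ι → X))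
    (B : Finset (ι → Y)) (S : Finset ι) :
    corr K A B S =
      ∑ α, ∑ β, #(fiber A S α) * #(fiber B S β) * ∏ i : S, K (α i) (β i) := by
  have tensor (x : ι → X) (y : ι → Y) : ∏ i ∈ S, K (x i) (y i) =
      ∏ i : S, K (S.restrict x i) (S.restrict y i) :=
    (prod_coe_sort S fun i => K (x i) (y i)).symm
  simp only [corr, tensor]
  rw [sum_comp_restrict A S fun α => ∑ y ∈ B, ∏ i : S, K (α i) (S.restrict y i)]
  refine sum_congr rfl fun α _ => ?_
  rw [sum_comp_restrict B S fun β => ∏ i : S, K (α i) (β i), mul_sum]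
  exact sum_congr rfl fun β _ => (mul_assoc _ _ _).symm

lemma sq_corr_le {K : X → Y → ℝ} {A : Finset (ι → X)} {B : Finset (ι → Y)} {S : Finset ι}
    {a b d : ℝ} (hd : boxSum K ≤ d ^ 4) (ha : ∀ α, (#(fiber A S α) : ℝ) ≤ a)
    (hb : ∀ β, (#(fiber B S β) : ℝ) ≤ b) :
    corr K A B S ^ 2 ≤ a * #A * (b * #B) * (d ^ #S) ^ 2 := by
  classical
  have hA := sum_card_fiber_sq_le A S ha
  have hB := sum_card_fiber_sq_le B S hb
  have hA₀ : 0 ≤ a * #A := (sum_nonneg fun _ _ => sq_nonneg _).trans hA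
  have hB₀ : 0 ≤ b * #B := (sum_nonneg fun _ _ => sq_nonneg _).trans hB
  refine le_of_sq_le_sq ?_ (by positivity)
  calc (corr K A B S ^ 2) ^ 2 = corr K A B S ^ 4 := by ring
    _ ≤ (∑ α, (#(fiber A S α) : ℝ) ^ 2) ^ 2 * (∑ β, (#(fiber B S β) : ℝ) ^ 2) ^ 2 *
          boxSum K ^ #S := by
        rw [corr_eq_sum_fiber, ← Fintype.card_coe S, ← boxSum_tensor_pow]
        exact bilinear_pow_four_le _ _ _
    _ ≤ (a * #A) ^ 2 * (b * #B) ^ 2 * (d ^ 4) ^ #S := by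
        have := boxSum_nonneg K
        gcongr
    _ = (a * #A * (b * #B) * (d ^ #S) ^ 2) ^ 2 := by ring

end Corr

section Hits

variable {ι X Y : Type*}

/-- The number of pairs in `A × B` whose `g`-values agree with `z` on the coordinates in `T`. -/
def hits (g : X → Y → Bool) (z : ι → Bool) (T : Finset ι) (A : Finset (ι → X))
    (B : Finset (ι → Y)) : ℝ :=
  ∑ x ∈ A, ∑ y ∈ B, if ∀ i ∈ T, g (x i) (y i) = z i then 1 else 0

variable (g : X → Y → Bool) (z : ι → Bool) (T : Finset ι) (A : Finset (ι → X))
  (B : Finset (ι → Y))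

lemma hits_nonneg : 0 ≤ hits g z T A B :=
  sum_nonneg fun _ _ => sum_nonneg fun _ _ => by split_ifs <;> norm_num

lemma hits_swap : hits (Function.swap g) z T B A = hits g z T A B := sum_comm

variable {g z T A B}

lemma hits_pos_iff : 0 < hits g z T A B ↔ ∃ x ∈ A, ∃ y ∈ B, ∀ i ∈ T, g (x i) (y i) = z i := by
  have term_nonneg (x : ι → X) (y : ι → Y) :
      (0 : ℝ) ≤ if ∀ i ∈ T, g (x i) (y i) = z i then 1 else 0 := by
    split_ifs <;> norm_num
  rw [hits, sum_pos_iff_of_nonneg fun x _ => sum_nonneg fun y _ => term_nonneg x y]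
  refine exists_congr fun x => and_congr_right fun _ => ?_
  rw [sum_pos_iff_of_nonneg fun y _ => term_nonneg x y]
  refine exists_congr fun y => and_congr_right fun _ => ?_
  split_ifs with h
  · exact iff_of_true one_pos h
  · exact iff_of_false (lt_irrefl 0) h

lemma hits_antitone {T' : Finset ι} (h : T ⊆ T') : hits g z T' A B ≤ hits g z T A B := by
  refine sum_le_sum fun x _ => sum_le_sum fun y _ => ?_
  split_ifs with h' h''
  · exact le_rfl
  · exact absurd (fun i hi => h' i (h hi)) h''
  all_goals norm_num

lemma hits_sdiff_add [DecidableEq (ι → X)] {A' : Finset (ι → X)} (h : A' ⊆ A) :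
    hits g z T (A \ A') B + hits g z T A' B = hits g z T A B :=
  sum_sdiff h

lemma sum_hits_fiber [Fintype Y] [DecidableEq Y] [DecidableEq ι] (S : Finset ι) :
    ∑ β, hits g z T A (fiber B S β) = hits g z T A B := by
  simp only [hits]
  rw [sum_comm]
  exact sum_congr rfl fun x _ => sum_fiberwise B S.restrict _

lemma hits_eq_sum_corr :
    hits g z T A B = (1 / 2) ^ #T *
      ∑ S ∈ T.powerset, (∏ i ∈ S, sgn (z i)) * corr (fun a b => sgn (g a b)) A B S := by
  classical
  have expand (x : ι → X) (y : ι → Y) :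
      (if ∀ i ∈ T, g (x i) (y i) = z i then (1 : ℝ) else 0) =
        (1 / 2) ^ #T * ∑ S ∈ T.powerset, (∏ i ∈ S, sgn (z i)) * ∏ i ∈ S, sgn (g (x i) (y i)) := by
    simp only [← prod_mul_distrib]
    rw [← prod_one_add, ← prod_const, ← prod_mul_distrib, ← prod_boole]
    refine prod_congr rfl fun i _ => ?_
    rw [indicator_eq_sgn]
    ring
  simp only [hits, expand, corr, ← mul_sum]
  congr 1
  simp only [mul_sum]
  calc _ = ∑ x ∈ A, ∑ S ∈ T.powerset, ∑ y ∈ B, _ := sum_congr rfl fun x _ => sum_comm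
    _ = _ := sum_comm

lemma abs_prod_sgn (S : Finset ι) (z : ι → Bool) : |∏ i ∈ S, sgn (z i)| = 1 := by
  simp only [abs_prod, abs_sgn, prod_const_one]

lemma hits_le_of_abs_corr_le {c d M : ℝ}
    (h : ∀ S ⊆ T, |corr (fun a b => sgn (g a b)) A B S| ≤ c * (d ^ #S * M ^ (#T - #S))) :
    hits g z T A B ≤ c * ((d + M) / 2) ^ #T := by
  calc hits g z T A B
      ≤ (1 / 2) ^ #T * ∑ S ∈ T.powerset, c * (d ^ #S * M ^ (#T - #S)) := by
        rw [hits_eq_sum_corr]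
        refine mul_le_mul_of_nonneg_left (sum_le_sum fun S hS => ?_) (by positivity)
        refine (le_abs_self _).trans ?_
        rw [abs_mul, abs_prod_sgn, one_mul]
        exact h S (mem_powerset.1 hS)
    _ = c * ((d + M) / 2) ^ #T := by
        rw [← mul_sum, sum_pow_mul_eq_add_pow, div_eq_mul_one_div (d + M), mul_pow]
        ring

lemma one_add_pow_lt_two {x : ℝ} {m : ℕ} (hx : 0 ≤ x) (h : m * x ≤ 1 / 2) : (1 + x) ^ m < 2 := by
  calc (1 + x) ^ m ≤ Real.exp x ^ m := by
        gcongr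
        linarith [Real.add_one_le_exp x]
    _ = Real.exp (m * x) := (Real.exp_nat_mul _ _).symm
    _ ≤ Real.exp (1 / 2) := by gcongr
    _ < 2 := by
        rw [← Real.lt_log_iff_exp_lt two_pos]
        linarith [Real.log_two_gt_d9]

lemma hits_pos_of_abs_corr_le {ρ : ℝ} (hA : A.Nonempty) (hB : B.Nonempty) (hρ : 0 ≤ ρ)
    (hT : #T * ρ ≤ 1 / 2)
    (h : ∀ S ⊆ T, S.Nonempty → |corr (fun a b => sgn (g a b)) A B S| ≤ #A * #B * ρ ^ #S) :
    0 < hits g z T A B := by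
  classical
  have hempty := empty_mem_powerset T
  have hpow : 1 + ∑ S ∈ T.powerset.erase ∅, ρ ^ #S = (1 + ρ) ^ #T := by
    rw [add_comm 1 ρ, ← sum_pow_mul_eq_add_pow, ← add_sum_erase _ _ hempty]
    simp
  have hnonempty : -(#A * #B * ∑ S ∈ T.powerset.erase ∅, ρ ^ #S) ≤
      ∑ S ∈ T.powerset.erase ∅, (∏ i ∈ S, sgn (z i)) * corr (fun a b => sgn (g a b)) A B S := by
    rw [mul_sum, ← sum_neg_distrib]
    refine sum_le_sum fun S hS => ?_
    rw [mem_erase, mem_powerset, ← nonempty_iff_ne_empty] at hS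
    refine neg_le_of_abs_le ?_
    rw [abs_mul, abs_prod_sgn, one_mul]
    exact h S hS.2 hS.1
  have hcorr : corr (fun a b => sgn (g a b)) A B ∅ = #A * #B := by simp [corr]
  have hAB : (0 : ℝ) < #A * #B := by
    exact_mod_cast Nat.mul_pos hA.card_pos hB.card_pos
  rw [hits_eq_sum_corr, ← add_sum_erase _ _ hempty, prod_empty, one_mul, hcorr]
  have hlt := mul_lt_mul_of_pos_left (one_add_pow_lt_two hρ hT) hAB
  rw [← hpow] at hlt
  exact mul_pos (by positivity) (by linarith)

end Hits

section ConstOn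

variable {ι X : Type*}

/-- All elements of `A` agree on the coordinates in `I`. -/
def ConstOn (I : Finset ι) (A : Finset (ι → X)) : Prop :=
  ∀ x ∈ A, ∀ x' ∈ A, ∀ i ∈ I, x i = x' i

lemma constOn_empty (A : Finset (ι → X)) : ConstOn ∅ A := by simp [ConstOn]

namespace ConstOn

variable {I : Finset ι} {A : Finset (ι → X)}

lemma mono {A' : Finset (ι → X)} (h : ConstOn I A) (hA : A' ⊆ A) : ConstOn I A' :=
  fun x hx x' hx' => h x (hA hx) x' (hA hx')

lemma fiber [DecidableEq X] [DecidableEq ι] (h : ConstOn I A) (S : Finset ι) (α : S → X) :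
    ConstOn (I ∪ S) (fiber A S α) := by
  intro x hx x' hx' i hi
  obtain ⟨hxA, hxα⟩ := mem_filter.1 hx
  obtain ⟨hxA', hxα'⟩ := mem_filter.1 hx'
  rcases mem_union.1 hi with hi | hi
  · exact h x hxA x' hxA' i hi
  · exact congrFun (hxα.trans hxα'.symm) ⟨i, hi⟩

variable [Fintype ι] [DecidableEq ι] [Fintype X]

lemma card_le (h : ConstOn I A) : #A ≤ Fintype.card X ^ #Iᶜ := by
  have inj := card_le_card_of_injOn (s := A) (t := (univ : Finset (↥Iᶜ → X))) (Iᶜ).restrict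
    (by simp) fun x hx x' hx' hxx' => funext fun i => by
      by_cases hi : i ∈ I
      · exact h x hx x' hx' i hi
      · exact congrFun hxx' ⟨i, mem_compl.2 hi⟩
  rwa [card_univ, Fintype.card_fun, Fintype.card_coe] at inj

lemma card_fiber_le [DecidableEq X] (h : ConstOn I A) {S : Finset ι} (hS : S ⊆ Iᶜ)
    (α : S → X) :
    (#(Lifting.fiber A S α) : ℝ) ≤ (Fintype.card X : ℝ) ^ (#Iᶜ - #S) := by
  have := (h.fiber S α).card_le
  rw [compl_union, ← sdiff_eq_inter_compl, card_sdiff_of_subset hS] at this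
  exact_mod_cast this

end ConstOn

end ConstOn

section Rectangle

variable {ι X Y : Type*} [Fintype ι] [DecidableEq ι] [Fintype X] [Fintype Y]
  {I : Finset ι} {A : Finset (ι → X)} {B : Finset (ι → Y)} {d M : ℝ}

lemma abs_corr_le_of_constOn {K : X → Y → ℝ} (hA : ConstOn I A) (hB : ConstOn I B)
    (hK : boxSum K ≤ d ^ 4) (hd : 0 ≤ d) (hM : (Fintype.card X : ℝ) * Fintype.card Y = M ^ 2)
    (hM₀ : 0 ≤ M) {S : Finset ι} (hS : S ⊆ Iᶜ) :
    |corr K A B S| ≤ √(#A * #B) * (d ^ #S * M ^ (#Iᶜ - #S)) := by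
  classical
  refine abs_le_of_sq_le_sq ?_ (by positivity)
  calc corr K A B S ^ 2
      ≤ Fintype.card X ^ (#Iᶜ - #S) * #A * (Fintype.card Y ^ (#Iᶜ - #S) * #B) * (d ^ #S) ^ 2 :=
        sq_corr_le hK (hA.card_fiber_le hS) (hB.card_fiber_le hS)
    _ = #A * #B * (d ^ #S) ^ 2 *
          ((Fintype.card X : ℝ) * Fintype.card Y) ^ (#Iᶜ - #S) := by
        rw [mul_pow]
        ring
    _ = (√(#A * #B) * (d ^ #S * M ^ (#Iᶜ - #S))) ^ 2 := by
        rw [hM, mul_pow (√_), Real.sq_sqrt (by positivity)]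
        ring

lemma sq_hits_le_of_constOn {g : X → Y → Bool} (z : ι → Bool) (hA : ConstOn I A)
    (hB : ConstOn I B) (hg : boxSum (fun a b => sgn (g a b)) ≤ d ^ 4) (hd : 0 ≤ d)
    (hM : (Fintype.card X : ℝ) * Fintype.card Y = M ^ 2) (hM₀ : 0 ≤ M) :
    hits g z univ A B ^ 2 ≤ #A * #B * (((d + M) / 2) ^ #Iᶜ) ^ 2 := by
  have hits_le : hits g z univ A B ≤ √(#A * #B) * ((d + M) / 2) ^ #Iᶜ :=
    (hits_antitone (subset_univ _)).trans <| hits_le_of_abs_corr_le fun S hS =>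
      abs_corr_le_of_constOn hA hB hg hd hM hM₀ hS
  calc hits g z univ A B ^ 2 ≤ (√(#A * #B) * ((d + M) / 2) ^ #Iᶜ) ^ 2 :=
        pow_le_pow_left₀ (hits_nonneg ..) hits_le 2
    _ = #A * #B * (((d + M) / 2) ^ #Iᶜ) ^ 2 := by
        rw [mul_pow, Real.sq_sqrt (by positivity)]

end Rectangle

section Extremal

variable {ι X Y : Type*} [Fintype ι]

/-- The quantity that the extremal rectangle maximises: the squared number of pairs of `A × B`
on which `g` takes the value `z`, per unit of area, with a reward `w` for each coordinate in `I`.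
It is `0` on empty rectangles. -/
noncomputable def score (g : X → Y → Bool) (z : ι → Bool) (w : ℝ) (I : Finset ι)
    (A : Finset (ι → X)) (B : Finset (ι → Y)) : ℝ :=
  hits g z univ A B ^ 2 * w ^ #I / (#A * #B)

/-- The rectangle `A × B` hits `z`, is constant on the coordinates in `I`, and its score cannot be
increased by passing to a subrectangle together with a set of coordinates on which that one is
constant. -/
structure IsExtremal (g : X → Y → Bool) (z : ι → Bool) (w : ℝ) (I : Finset ι)
    (A : Finset (ι → X)) (B : Finset (ι → Y)) : Prop where
  constOn_left : ConstOn I A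
  constOn_right : ConstOn I B
  hits_pos : 0 < hits g z univ A B
  score_le : ∀ I' A' B', A' ⊆ A → B' ⊆ B → ConstOn I' A' → ConstOn I' B' →
    score g z w I' A' B' ≤ score g z w I A B

variable {g : X → Y → Bool} {z : ι → Bool} {w : ℝ} {I : Finset ι} {A : Finset (ι → X)}
  {B : Finset (ι → Y)}

lemma score_swap : score (Function.swap g) z w I B A = score g z w I A B := by
  rw [score, score, hits_swap, mul_comm (#A : ℝ)]

lemma score_pos (hw : 0 < w) (h : 0 < hits g z univ A B) : 0 < score g z w I A B := by
  obtain ⟨x, hx, y, hy, -⟩ := hits_pos_iff.1 h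
  have := card_pos.2 ⟨x, hx⟩
  have := card_pos.2 ⟨y, hy⟩
  unfold score
  positivity

lemma sq_hits_le_mul_score [Fintype X] [Fintype Y] (h : 0 < hits g z univ A B) :
    hits g z univ A B ^ 2 ≤
      ((Fintype.card X : ℝ) * Fintype.card Y) ^ Fintype.card ι * score g z w ∅ A B := by
  classical
  obtain ⟨x, hx, y, hy, -⟩ := hits_pos_iff.1 h
  have := card_pos.2 ⟨x, hx⟩
  have := card_pos.2 ⟨y, hy⟩
  have hA : (#A : ℝ) ≤ (Fintype.card X : ℝ) ^ Fintype.card ι := by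
    exact_mod_cast (card_le_univ A).trans_eq Fintype.card_fun
  have hB : (#B : ℝ) ≤ (Fintype.card Y : ℝ) ^ Fintype.card ι := by
    exact_mod_cast (card_le_univ B).trans_eq Fintype.card_fun
  rw [score, card_empty, pow_zero, mul_one, mul_div_assoc', le_div_iff₀ (by positivity),
    mul_comm, mul_pow]
  gcongr

lemma exists_isExtremal (hw : 0 < w) (h : 0 < hits g z univ A B) :
    ∃ I, ∃ A' ⊆ A, ∃ B' ⊆ B, IsExtremal g z w I A' B' ∧
      score g z w ∅ A B ≤ score g z w I A' B' := by
  classical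
  let candidates := (univ ×ˢ A.powerset ×ˢ B.powerset).filter fun R =>
    ConstOn R.1 R.2.1 ∧ ConstOn R.1 R.2.2
  have whole_mem : (∅, A, B) ∈ candidates := by simp [candidates, constOn_empty]
  obtain ⟨⟨I, A', B'⟩, hmem, hmax⟩ :=
    exists_max_image candidates (fun R => score g z w R.1 R.2.1 R.2.2) ⟨_, whole_mem⟩
  simp only [candidates, mem_filter, mem_product, mem_univ, mem_powerset, true_and] at hmem hmax
  obtain ⟨⟨hA, hB⟩, hIA, hIB⟩ := hmem
  have hscore := hmax (∅, A, B) ⟨⟨subset_rfl, subset_rfl⟩, constOn_empty A, constOn_empty B⟩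
  refine ⟨I, A', hA, B', hB, ⟨hIA, hIB, ?_, fun I₁ A₁ B₁ hA₁ hB₁ hIA₁ hIB₁ => ?_⟩, hscore⟩
  · refine (hits_nonneg ..).lt_of_ne fun h₀ => ?_
    have := (score_pos hw h).trans_le hscore
    simp [score, ← h₀] at this
  · exact hmax (I₁, A₁, B₁) ⟨⟨hA₁.trans hA, hB₁.trans hB⟩, hIA₁, hIB₁⟩

namespace IsExtremal

lemma swap (h : IsExtremal g z w I A B) : IsExtremal (Function.swap g) z w I B A where
  constOn_left := h.constOn_right
  constOn_right := h.constOn_left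
  hits_pos := hits_swap g z univ A B ▸ h.hits_pos
  score_le I' B' A' hB hA hIB hIA := by
    calc _ = score g z w I' A' B' := score_swap
      _ ≤ score g z w I A B := h.score_le I' A' B' hA hB hIA hIB
      _ = _ := score_swap.symm

lemma left_nonempty (h : IsExtremal g z w I A B) : A.Nonempty :=
  let ⟨x, hx, _⟩ := hits_pos_iff.1 h.hits_pos
  ⟨x, hx⟩

lemma sq_hits_mul_le (h : IsExtremal g z w I A B) {I' : Finset ι} {A' : Finset (ι → X)}
    {B' : Finset (ι → Y)} (hA : A' ⊆ A) (hB : B' ⊆ B) (hIA : ConstOn I' A')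
    (hIB : ConstOn I' B') :
    hits g z univ A' B' ^ 2 * w ^ #I' * (#A * #B) ≤
      hits g z univ A B ^ 2 * w ^ #I * (#A' * #B') := by
  rcases A'.eq_empty_or_nonempty with rfl | hA'
  · simp [hits]
  rcases B'.eq_empty_or_nonempty with rfl | hB'
  · simp [hits]
  have := hA'.card_pos
  have := hB'.card_pos
  have := h.left_nonempty.card_pos
  have := h.swap.left_nonempty.card_pos
  exact (div_le_div_iff₀ (by positivity) (by positivity)).1 (h.score_le I' A' B' hA hB hIA hIB)

/-- Otherwise removing `A'` from `A` would increase the score. -/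
lemma hits_mul_card_le (h : IsExtremal g z w I A B) (hw : 0 < w) {A' : Finset (ι → X)}
    (hA : A' ⊆ A) : hits g z univ A B * #A' ≤ 2 * hits g z univ A' B * #A := by
  classical
  have removed := h.sq_hits_mul_le sdiff_subset subset_rfl (h.constOn_left.mono sdiff_subset)
    h.constOn_right (A' := A \ A')
  rw [eq_sub_of_add_eq (hits_sdiff_add hA), card_sdiff_of_subset hA,
    Nat.cast_sub (card_le_card hA)] at removed
  have hB := h.swap.left_nonempty.card_pos
  have cancelled : (hits g z univ A B - hits g z univ A' B) ^ 2 * #A ≤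
      hits g z univ A B ^ 2 * (#A - #A') := by
    refine le_of_mul_le_mul_right ?_ (by positivity : 0 < w ^ #I * (#B : ℝ))
    linarith
  refine le_of_mul_le_mul_left ?_ h.hits_pos
  nlinarith [mul_nonneg (sq_nonneg (hits g z univ A' B)) (Nat.cast_nonneg (α := ℝ) #A)]

variable [DecidableEq ι] [Fintype Y]

lemma sq_hits_fiber_mul_le [DecidableEq X] (h : IsExtremal g z w I A B) (hw : 0 < w) {S : Finset ι}
    (hS : S ⊆ Iᶜ) (α : S → X) :
    hits g z univ (fiber A S α) B ^ 2 * (w ^ #S * #A) ≤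
      Fintype.card Y ^ #S * (hits g z univ A B ^ 2 * #(fiber A S α)) := by
  classical
  have hB := h.swap.left_nonempty.card_pos
  have fiber_le (β : S → Y) :
      hits g z univ (fiber A S α) (fiber B S β) ^ 2 * (w ^ #S * #A * #B) ≤
        hits g z univ A B ^ 2 * #(fiber A S α) * #(fiber B S β) := by
    have := h.sq_hits_mul_le (fiber_subset A S α) (fiber_subset B S β)
      (h.constOn_left.fiber S α) (h.constOn_right.fiber S β)
    rw [card_union_of_disjoint (disjoint_right.2 fun i hi => mem_compl.1 (hS hi)),
      pow_add] at this
    refine le_of_mul_le_mul_right ?_ (by positivity : 0 < w ^ #I)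
    linarith
  have cauchy_schwarz : hits g z univ (fiber A S α) B ^ 2 ≤
      Fintype.card Y ^ #S * ∑ β, hits g z univ (fiber A S α) (fiber B S β) ^ 2 := by
    rw [← sum_hits_fiber S]
    simpa using sq_sum_le_card_mul_sum_sq (s := univ)
      (f := fun β => hits g z univ (fiber A S α) (fiber B S β))
  refine le_of_mul_le_mul_right ?_ (Nat.cast_pos.2 hB : (0 : ℝ) < #B)
  calc hits g z univ (fiber A S α) B ^ 2 * (w ^ #S * #A) * #B
      ≤ Fintype.card Y ^ #S * (∑ β, hits g z univ (fiber A S α) (fiber B S β) ^ 2) *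
          (w ^ #S * #A) * #B := by gcongr
    _ = Fintype.card Y ^ #S * ∑ β, hits g z univ (fiber A S α) (fiber B S β) ^ 2 *
          (w ^ #S * #A * #B) := by
        rw [← sum_mul]
        ring
    _ ≤ Fintype.card Y ^ #S * ∑ β, hits g z univ A B ^ 2 * #(fiber A S α) * #(fiber B S β) :=
        mul_le_mul_of_nonneg_left (sum_le_sum fun β _ => fiber_le β) (by positivity)
    _ = Fintype.card Y ^ #S * (hits g z univ A B ^ 2 * #(fiber A S α)) * #B := by
        rw [← mul_sum, sum_card_fiber, ← mul_assoc]

lemma card_fiber_le [DecidableEq X] (h : IsExtremal g z w I A B) (hw : 0 < w) {S : Finset ι}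
    (hS : S ⊆ Iᶜ) (α : S → X) :
    (#(fiber A S α) : ℝ) ≤ 4 * (Fintype.card Y / w) ^ #S * #A := by
  rcases (fiber A S α).eq_empty_or_nonempty with hα | hα
  · rw [hα]
    simp only [card_empty, Nat.cast_zero]
    positivity
  have := hα.card_pos
  have he := h.hits_pos
  rw [div_pow, mul_div_assoc', div_mul_eq_mul_div, le_div_iff₀ (by positivity)]
  refine le_of_mul_le_mul_right ?_
    (by positivity : 0 < hits g z univ A B ^ 2 * (#(fiber A S α) : ℝ))
  calc #(fiber A S α) * w ^ #S * (hits g z univ A B ^ 2 * #(fiber A S α))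
      = w ^ #S * (hits g z univ A B * #(fiber A S α)) ^ 2 := by ring
    _ ≤ w ^ #S * (2 * hits g z univ (fiber A S α) B * #A) ^ 2 :=
        mul_le_mul_of_nonneg_left (pow_le_pow_left₀ (by positivity)
          (h.hits_mul_card_le hw (fiber_subset A S α)) 2) (by positivity)
    _ = 4 * #A * (hits g z univ (fiber A S α) B ^ 2 * (w ^ #S * #A)) := by ring
    _ ≤ 4 * #A * (Fintype.card Y ^ #S * (hits g z univ A B ^ 2 * #(fiber A S α))) :=
        mul_le_mul_of_nonneg_left (h.sq_hits_fiber_mul_le hw hS α) (by positivity)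
    _ = _ := by ring

variable [Fintype X] {K : X → Y → ℝ} {d M : ℝ}

lemma abs_corr_le (h : IsExtremal g z w I A B) (hw : 0 < w) (hK : boxSum K ≤ d ^ 4) (hd : 0 ≤ d)
    (hM : (Fintype.card X : ℝ) * Fintype.card Y = M ^ 2) (hM₀ : 0 ≤ M) {S : Finset ι}
    (hS : S ⊆ Iᶜ) (hS₀ : S.Nonempty) :
    |corr K A B S| ≤ #A * #B * (4 * (M / w * d)) ^ #S := by
  classical
  refine abs_le_of_sq_le_sq ?_ (by positivity)
  have four_le : (4 : ℝ) ≤ 4 ^ #S := le_self_pow₀ (by norm_num) hS₀.card_ne_zero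
  calc corr K A B S ^ 2
      ≤ 4 * (Fintype.card Y / w) ^ #S * #A * #A * (4 * (Fintype.card X / w) ^ #S * #B * #B) *
          (d ^ #S) ^ 2 :=
        sq_corr_le hK (h.card_fiber_le hw hS) (h.swap.card_fiber_le hw hS)
    _ = (#A * #B * (4 * (d / w) ^ #S)) ^ 2 *
          ((Fintype.card X : ℝ) * Fintype.card Y) ^ #S := by
        simp only [div_pow, mul_pow]
        ring
    _ ≤ (#A * #B * (4 ^ #S * (d / w) ^ #S)) ^ 2 *
          ((Fintype.card X : ℝ) * Fintype.card Y) ^ #S := by gcongr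
    _ = (#A * #B * (4 * (M / w * d)) ^ #S) ^ 2 := by
        rw [hM]
        simp only [div_pow, mul_pow]
        ring

lemma exists_eq (h : IsExtremal g z w I A B) (hw : 0 < w)
    (hg : boxSum (fun a b => sgn (g a b)) ≤ d ^ 4) (hd : 0 ≤ d)
    (hM : (Fintype.card X : ℝ) * Fintype.card Y = M ^ 2) (hM₀ : 0 ≤ M)
    (hI : #Iᶜ * (4 * (M / w * d)) ≤ 1 / 2) {z' : ι → Bool} (hz' : ∀ i ∈ I, z' i = z i) :
    ∃ x ∈ A, ∃ y ∈ B, ∀ i, g (x i) (y i) = z' i := by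
  have pos : 0 < hits g z' Iᶜ A B :=
    hits_pos_of_abs_corr_le h.left_nonempty h.swap.left_nonempty (by positivity) hI
      fun S hS hS₀ => h.abs_corr_le hw hg hd hM hM₀ hS hS₀
  obtain ⟨x, hx, y, hy, hxy⟩ := hits_pos_iff.1 pos
  obtain ⟨a, ha, b, hb, hab⟩ := hits_pos_iff.1 h.hits_pos
  refine ⟨x, hx, y, hy, fun i => ?_⟩
  by_cases hi : i ∈ I
  · rw [hz' i hi, ← hab i (mem_univ i), h.constOn_left x hx a ha i hi,
      h.constOn_right y hy b hb i hi]
  · exact hxy i (mem_compl.2 hi)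

lemma score_le_pow (h : IsExtremal g z w I A B) (hw : 0 < w)
    (hg : boxSum (fun a b => sgn (g a b)) ≤ d ^ 4) (hd : 0 ≤ d)
    (hM : (Fintype.card X : ℝ) * Fintype.card Y = M ^ 2) (hM₀ : 0 ≤ M) :
    score g z w I A B ≤ w ^ #I * (((d + M) / 2) ^ #Iᶜ) ^ 2 := by
  have hA := h.left_nonempty.card_pos
  have hB := h.swap.left_nonempty.card_pos
  rw [score, div_le_iff₀ (by positivity)]
  calc hits g z univ A B ^ 2 * w ^ #I ≤ #A * #B * (((d + M) / 2) ^ #Iᶜ) ^ 2 * w ^ #I := by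
        gcongr
        exact sq_hits_le_of_constOn z h.constOn_left h.constOn_right hg hd hM hM₀
    _ = _ := by ring

/-- With `r * M` in place of `w` and `ε * M` in place of `d`, the factor `(M ^ 2 / 2) ^ card ι` is
the number of hits to expect in the full rectangle. -/
lemma hits_le_of_score_le {r ε : ℝ} (h : IsExtremal g z ((r * M) ^ 2) I A B) (hr : 0 < r)
    (hε : 0 ≤ ε) (hg : boxSum (fun a b => sgn (g a b)) ≤ (ε * M) ^ 4)
    (hM : (Fintype.card X : ℝ) * Fintype.card Y = M ^ 2) (hM₀ : 0 < M)
    {A₀ : Finset (ι → X)} {B₀ : Finset (ι → Y)} (h₀ : 0 < hits g z univ A₀ B₀)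
    (hscore : score g z ((r * M) ^ 2) ∅ A₀ B₀ ≤ score g z ((r * M) ^ 2) I A B) :
    hits g z univ A₀ B₀ ≤
      (M ^ 2 / 2) ^ Fintype.card ι * ((2 * r) ^ #I * (1 + ε) ^ #Iᶜ) := by
  refine le_of_sq_le_sq ?_ (by positivity)
  calc hits g z univ A₀ B₀ ^ 2
      ≤ ((Fintype.card X : ℝ) * Fintype.card Y) ^ Fintype.card ι * score g z _ ∅ A₀ B₀ :=
        sq_hits_le_mul_score h₀
    _ ≤ (M ^ 2) ^ Fintype.card ι *
          (((r * M) ^ 2) ^ #I * (((ε * M + M) / 2) ^ #Iᶜ) ^ 2) := by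
        rw [hM]
        gcongr
        exact hscore.trans (h.score_le_pow (by positivity) hg (by positivity) hM hM₀.le)
    _ = ((M * (r * M)) ^ #I * (M * ((ε * M + M) / 2)) ^ #Iᶜ) ^ 2 := by
        rw [← card_add_card_compl I]
        generalize (ε * M + M) / 2 = s
        ring
    _ = ((M ^ 2 / 2 * (2 * r)) ^ #I * (M ^ 2 / 2 * (1 + ε)) ^ #Iᶜ) ^ 2 := by
        congr 3 <;> ring
    _ = ((M ^ 2 / 2) ^ Fintype.card ι * ((2 * r) ^ #I * (1 + ε) ^ #Iᶜ)) ^ 2 := by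
        rw [← card_add_card_compl I, pow_add, mul_mul_mul_comm, ← mul_pow, ← mul_pow]

end IsExtremal

end Extremal

section Certificate

lemma hits_univ_eq_prod {ι X Y : Type*} [Fintype ι] [DecidableEq ι] [Fintype X] [Fintype Y]
    (g : X → Y → Bool) (z : ι → Bool) :
    hits g z univ univ univ = ∏ i, ∑ a, ∑ b, if g a b = z i then 1 else 0 := by
  simp only [hits, prod_univ_sum, Fintype.piFinset_univ, ← prod_boole]

variable {ι : Type*} [Fintype ι] [DecidableEq ι] {Λ : Type} [Fintype Λ] {g : Λ → Λ → Bool}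

lemma half_pow_le_hits_univ (z : ι → Bool) (hg : disc g ≤ 1)
    (hι : Fintype.card ι * disc g ≤ 1 / 2) :
    ((Fintype.card Λ : ℝ) ^ 2 / 2) ^ Fintype.card ι / 2 ≤ hits g z univ univ univ := by
  have bernoulli := one_add_mul_le_pow (a := -disc g) (by linarith) (Fintype.card ι)
  calc ((Fintype.card Λ : ℝ) ^ 2 / 2) ^ Fintype.card ι / 2
      ≤ ((Fintype.card Λ : ℝ) ^ 2 / 2) ^ Fintype.card ι * (1 - disc g) ^ Fintype.card ι := by
        rw [div_eq_mul_inv _ (2 : ℝ)]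
        refine mul_le_mul_of_nonneg_left ?_ (by positivity)
        rw [sub_eq_add_neg]
        linarith
    _ = ∏ _i : ι, (Fintype.card Λ : ℝ) ^ 2 / 2 * (1 - disc g) := by
        rw [prod_const, card_univ, mul_pow]
    _ ≤ hits g z univ univ univ := by
        rw [hits_univ_eq_prod]
        have := sub_nonneg.2 hg
        exact prod_le_prod (fun _ _ => by positivity) fun i _ => le_sum_indicator_eq g (z i)

lemma half_pow_le_hits_univ_of_disc_le (z : ι → Bool) {p : ℝ} (hp : 1 ≤ p)
    (hι : 16 * Fintype.card ι ≤ p ^ 4) (hg : disc g ≤ (p ^ 32)⁻¹) :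
    ((Fintype.card Λ : ℝ) ^ 2 / 2) ^ Fintype.card ι / 2 ≤ hits g z univ univ univ := by
  refine half_pow_le_hits_univ z (hg.trans (inv_le_one_of_one_le₀ (one_le_pow₀ hp))) ?_
  calc Fintype.card ι * disc g ≤ Fintype.card ι * (p ^ 4)⁻¹ := by
        gcongr
        exact hg.trans (inv_anti₀ (by positivity) (pow_le_pow_right₀ hp (by norm_num)))
    _ ≤ 1 / 2 := by
        rw [← div_eq_mul_inv, div_le_iff₀ (by positivity)]
        linarith [show 0 ≤ p ^ 4 by positivity]

lemma pow_le_of_one_le_mul_two_div_sq_pow {p T : ℝ} {k : ℕ} (hp : 8 ≤ p) (hT : 1 ≤ T)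
    (h : 1 ≤ 4 * T * (2 / p ^ 2) ^ k) : p ^ k ≤ T := by
  obtain rfl | hk := eq_or_ne k 0
  · rwa [pow_zero]
  have hfour : 4 ≤ (p / 2) ^ k := by
    calc (4 : ℝ) ≤ 4 ^ k := le_self_pow₀ (by norm_num) hk
      _ ≤ (p / 2) ^ k := pow_le_pow_left₀ (by norm_num) (by linarith) k
  have hinv : (2 / p ^ 2) ^ k * ((p / 2) ^ k * p ^ k) = 1 := by
    have : 2 / p ^ 2 * (p / 2 * p) = 1 := by field_simp
    rw [← mul_pow, ← mul_pow, this, one_pow]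
  have hmul : (p / 2) ^ k * p ^ k ≤ 4 * T := by
    calc (p / 2) ^ k * p ^ k ≤ 4 * T * (2 / p ^ 2) ^ k * ((p / 2) ^ k * p ^ k) :=
          le_mul_of_one_le_left (by positivity) h
      _ = 4 * T := by rw [mul_assoc, hinv, mul_one]
  linarith [mul_le_mul_of_nonneg_right hfour (by positivity : 0 ≤ p ^ k)]

lemma pow_le_of_half_le_mul {p T H E : ℝ} {k m : ℕ} (hp : 8 ≤ p) (hm : 16 * m ≤ p ^ 4)
    (hT : 1 ≤ T) (hH : 0 < H) (hfull : H / 2 ≤ T * E)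
    (hfew : E ≤ H * ((2 * (1 / p ^ 2)) ^ k * (1 + 2 / p ^ 8) ^ m)) : p ^ k ≤ T := by
  have htwo : (1 + 2 / p ^ 8) ^ m < 2 := by
    have : p ^ 4 ≤ p ^ 8 := pow_le_pow_right₀ (by linarith) (by norm_num)
    refine one_add_pow_lt_two (by positivity) ?_
    rw [mul_div_assoc', div_le_iff₀ (by positivity)]
    linarith
  refine pow_le_of_one_le_mul_two_div_sq_pow hp hT (le_of_mul_le_mul_left ?_ hH)
  calc H * 1 ≤ 2 * (T * E) := by linarith
    _ ≤ 2 * (T * (H * ((2 * (1 / p ^ 2)) ^ k * 2))) := by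
        gcongr
        exact hfew.trans (by gcongr)
    _ = H * (4 * T * (2 / p ^ 2) ^ k) := by ring

lemma boxSum_sgn_le_of_disc_le {p : ℝ} (hg : disc g ≤ (p ^ 32)⁻¹) :
    boxSum (fun a b => sgn (g a b)) ≤ (2 / p ^ 8 * Fintype.card Λ) ^ 4 := by
  calc _ ≤ 4 * (Fintype.card Λ : ℝ) ^ 4 * disc g := boxSum_sgn_le_disc g
    _ ≤ 4 * (Fintype.card Λ : ℝ) ^ 4 * (p ^ 32)⁻¹ := by gcongr
    _ ≤ 16 * (Fintype.card Λ : ℝ) ^ 4 * (p ^ 32)⁻¹ := by gcongr; norm_num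
    _ = _ := by ring

theorem exists_forall_eq_of_hits_univ_le [Nonempty Λ] {z : ι → Bool} {p T : ℝ} (hp : 8 ≤ p)
    (hι : 16 * Fintype.card ι ≤ p ^ 4) (hT : 1 ≤ T) (hg : disc g ≤ (p ^ 32)⁻¹)
    {A₀ B₀ : Finset (ι → Λ)} (h : hits g z univ univ univ ≤ T * hits g z univ A₀ B₀) :
    ∃ I : Finset ι, p ^ #I ≤ T ∧ ∀ z' : ι → Bool, (∀ i ∈ I, z' i = z i) →
      ∃ x ∈ A₀, ∃ y ∈ B₀, ∀ i, g (x i) (y i) = z' i := by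
  have : 0 < p := by linarith
  set N : ℝ := (Fintype.card Λ : ℝ)
  have hN : 0 < N := by positivity
  have hbox := boxSum_sgn_le_of_disc_le hg
  have hfull := half_pow_le_hits_univ_of_disc_le z (by linarith) hι hg
  have h₀ : 0 < hits g z univ A₀ B₀ := by
    have : 0 < T * hits g z univ A₀ B₀ := lt_of_lt_of_le (by positivity) (hfull.trans h)
    exact pos_of_mul_pos_right this (by linarith)
  have hw : 0 < (1 / p ^ 2 * N) ^ 2 := by positivity
  obtain ⟨I, A, hA, B, hB, hext, hscore⟩ := exists_isExtremal hw h₀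
  have hIc : 16 * #Iᶜ ≤ p ^ 4 := by
    have : (#Iᶜ : ℝ) ≤ Fintype.card ι := by exact_mod_cast card_le_univ _
    linarith
  refine ⟨I, pow_le_of_half_le_mul hp hIc hT (by positivity) (hfull.trans h) <|
    hext.hits_le_of_score_le (by positivity) (by positivity) hbox (sq N).symm hN h₀ hscore,
    fun z' hz' => ?_⟩
  have hI : #Iᶜ * (4 * (N / (1 / p ^ 2 * N) ^ 2 * (2 / p ^ 8 * N))) ≤ 1 / 2 := by
    have : 4 * (N / (1 / p ^ 2 * N) ^ 2 * (2 / p ^ 8 * N)) = 8 / p ^ 4 := by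
      field_simp
      norm_num
    rw [this, mul_div_assoc', div_le_iff₀ (by positivity)]
    linarith
  obtain ⟨x, hx, y, hy, hxy⟩ :=
    hext.exists_eq hw hbox (by positivity) (sq N).symm hN.le hI hz'
  exact ⟨x, hA hx, y, hB hy, hxy⟩

end Certificate

section Cover

lemma hits_eq_card {ι X Y : Type*} (g : X → Y → Bool) (z : ι → Bool)
    (T : Finset ι) (A : Finset (ι → X)) (B : Finset (ι → Y)) :
    hits g z T A B = #{q ∈ A ×ˢ B | ∀ i ∈ T, g (q.1 i) (q.2 i) = z i} := by
  rw [hits, ← sum_product', sum_boole]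

lemma exists_hits_univ_le_card_mul {ι κ X Y : Type*} [Fintype ι] [DecidableEq ι] [Fintype X]
    [Fintype Y] [Fintype κ] {g : X → Y → Bool} {z : ι → Bool}
    {A : κ → Finset (ι → X)} {B : κ → Finset (ι → Y)}
    (hz : 0 < hits g z univ univ univ)
    (hcover : ∀ x y, (∀ i, g (x i) (y i) = z i) → ∃ j, x ∈ A j ∧ y ∈ B j) :
    ∃ j, hits g z univ univ univ ≤ Fintype.card κ * hits g z univ (A j) (B j) := by
  classical
  obtain ⟨x, -, y, -, hxy⟩ := hits_pos_iff.1 hz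
  have : Nonempty κ := (hcover x y fun i => hxy i (mem_univ i)).nonempty
  have hsum : hits g z univ univ univ ≤ ∑ j, hits g z univ (A j) (B j) := by
    simp only [hits_eq_card]
    norm_cast
    refine (card_le_card fun q hq => ?_).trans card_biUnion_le
    replace hq : ∀ i, g (q.1 i) (q.2 i) = z i := by simpa using hq
    simpa [hq] using hcover q.1 q.2 hq
  obtain ⟨j, -, hj⟩ := exists_le_of_sum_le (s := univ) univ_nonempty
    (f := fun _ : κ => hits g z univ univ univ / Fintype.card κ) (by simpa [mul_div_cancel₀])
  exact ⟨j, (div_le_iff₀' (by positivity)).1 hj⟩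

end Cover

section CertificateComplexity

variable {n : ℕ} {f : (Fin n → Bool) → Bool}

/-- `I` is a certificate for the value of `f` at `z`: the bits `z i` with `i ∈ I` determine it. -/
def IsCertificate (f : (Fin n → Bool) → Bool) (z : Fin n → Bool) (I : Finset (Fin n)) : Prop :=
  ∀ z', (∀ i ∈ I, z' i = z i) → f z' = f z

lemma C₀_le_of_isCertificate {k : ℕ}
    (h : ∀ z, f z = false → ∃ I, #I ≤ k ∧ IsCertificate f z I) : C₀ f ≤ k := by
  classical
  choose! I hI hf using h
  refine Nat.sInf_le ⟨(univ.filter fun z => f z = false).toList.map fun z =>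
    (I z).image fun i => (i, z i), fun C hC => ?_, fun x => ?_⟩
  · obtain ⟨z, hz, rfl⟩ := List.mem_map.1 hC
    exact card_image_le.trans (hI z (by simpa using hz))
  · simp only [Bool.not_eq_true', List.mem_map, mem_toList, mem_filter, mem_univ, true_and,
      Conj.Sat]
    constructor
    · exact fun hx => ⟨_, ⟨x, hx, rfl⟩, by simp⟩
    · rintro ⟨_, ⟨z, hz, rfl⟩, hs⟩
      exact (hf z hz x fun i hi => hs (i, z i) (mem_image_of_mem _ hi)).trans hz

lemma exists_C₀_le_card (h : C₀ f ≠ 0) :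
    ∃ z, f z = false ∧ ∀ I, IsCertificate f z I → C₀ f ≤ #I := by
  by_contra! hsmall
  have : C₀ f ≤ C₀ f - 1 := C₀_le_of_isCertificate fun z hz =>
    (hsmall z hz).imp fun I hI => ⟨Nat.le_sub_one_of_lt hI.2, hI.1⟩
  exact h (by omega)

end CertificateComplexity

namespace NProtocol

variable {X Y : Type}

lemma card_sum_le_two_pow {ι κ : Type} [Fintype ι] [Fintype κ] {a b : ℕ}
    (hι : Fintype.card ι ≤ 2 ^ a) (hκ : Fintype.card κ ≤ 2 ^ b) :
    Fintype.card (ι ⊕ κ) ≤ 2 ^ (max a b + 1) := by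
  rw [Fintype.card_sum, pow_succ, mul_two]
  exact add_le_add (hι.trans (Nat.pow_le_pow_right two_pos (le_max_left a b)))
    (hκ.trans (Nat.pow_le_pow_right two_pos (le_max_right a b)))

lemma exists_rectangle_cover (P : NProtocol X Y) :
    ∃ (ι : Type) (_ : Fintype ι) (A : ι → Set X) (B : ι → Set Y),
      Fintype.card ι ≤ 2 ^ P.cost ∧ ∀ x y, P.Accepts x y ↔ ∃ i, x ∈ A i ∧ y ∈ B i := by
  induction P with
  | leaf a b =>
    exact ⟨Unit, inferInstance, fun _ => {x | a x}, fun _ => {y | b y}, by simp [cost],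
      fun x y => by simp [Accepts]⟩
  | alice s P Q hP hQ =>
    obtain ⟨ι, _, A, B, hι, h⟩ := hP
    obtain ⟨κ, _, A', B', hκ, h'⟩ := hQ
    refine ⟨ι ⊕ κ, inferInstance,
      Sum.elim (fun i => {x | false ∈ s x ∧ x ∈ A i}) (fun j => {x | true ∈ s x ∧ x ∈ A' j}),
      Sum.elim B B', card_sum_le_two_pow hι hκ, fun x y => ?_⟩
    simp [Accepts, h, h', and_assoc]
  | bob s P Q hP hQ =>
    obtain ⟨ι, _, A, B, hι, h⟩ := hP
    obtain ⟨κ, _, A', B', hκ, h'⟩ := hQ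
    refine ⟨ι ⊕ κ, inferInstance, Sum.elim A A',
      Sum.elim (fun i => {y | false ∈ s y ∧ y ∈ B i}) (fun j => {y | true ∈ s y ∧ y ∈ B' j}),
      card_sum_le_two_pow hι hκ, fun x y => ?_⟩
    simp only [Accepts, h, h', Sum.exists, Sum.elim_inl, Sum.elim_inr, Set.mem_ofPred_eq,
      ← exists_and_left, and_left_comm]

lemma exists_computes [Finite X] (F : X → Y → Bool) : ∃ P : NProtocol X Y, P.Computes F := by
  have on_list (L : List X) :
      ∃ P : NProtocol X Y, ∀ x y, (x ∈ L ∧ F x y = true) ↔ P.Accepts x y := by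
    induction L with
    | nil => exact ⟨leaf (fun _ => False) (fun _ => False), by simp [Accepts]⟩
    | cons a L ih =>
      obtain ⟨P, hP⟩ := ih
      refine ⟨alice (fun _ => Set.univ) (leaf (fun x => x = a) (fun y => F a y = true)) P, ?_⟩
      intro x y
      simp only [Accepts, ← hP, List.mem_cons, Set.mem_univ, true_and, or_and_right]
      refine or_congr_left (and_congr_right ?_)
      rintro rfl
      rfl
  have := Fintype.ofFinite X
  obtain ⟨P, hP⟩ := on_list univ.toList
  exact ⟨P, fun x y => by simp [← hP]⟩

end NProtocol

section Simulation

lemma exists_rectangle_cover_card_le_two_pow_coNPcc {X Y : Type} [Finite X] [Finite Y]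
    (F : X → Y → Bool) :
    ∃ (κ : Type) (_ : Fintype κ) (A : κ → Finset X) (B : κ → Finset Y),
      Fintype.card κ ≤ 2 ^ coNPcc F ∧ ∀ x y, F x y = false ↔ ∃ j, x ∈ A j ∧ y ∈ B j := by
  classical
  have := Fintype.ofFinite X
  have := Fintype.ofFinite Y
  obtain ⟨P₀, hP₀⟩ := NProtocol.exists_computes fun x y => !(F x y)
  obtain ⟨P, hP, hcost⟩ : coNPcc F ∈ {t | ∃ P : NProtocol X Y, P.Computes (fun x y => !(F x y)) ∧
      P.cost = t} := Nat.sInf_mem ⟨_, P₀, hP₀, rfl⟩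
  obtain ⟨κ, _, A, B, hκ, hAB⟩ := P.exists_rectangle_cover
  refine ⟨κ, inferInstance, fun j => univ.filter (· ∈ A j), fun j => univ.filter (· ∈ B j),
    hcost ▸ hκ, fun x y => ?_⟩
  simpa [hAB] using hP x y

theorem pow_C₀_le_two_pow_coNPcc {n ℓ : ℕ} (f : (Fin n → Bool) → Bool)
    {g : (Fin ℓ → Bool) → (Fin ℓ → Bool) → Bool} {p : ℝ} (hp : 8 ≤ p) (hn : 16 * n ≤ p ^ 4)
    (hg : disc g ≤ (p ^ 32)⁻¹) : p ^ C₀ f ≤ 2 ^ coNPcc (compose f g) := by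
  obtain hC | hC := eq_or_ne (C₀ f) 0
  · rw [hC, pow_zero]
    exact one_le_pow₀ one_le_two
  replace hn : 16 * (Fintype.card (Fin n) : ℝ) ≤ p ^ 4 := by rwa [Fintype.card_fin]
  obtain ⟨z, hz, hmin⟩ := exists_C₀_le_card hC
  obtain ⟨κ, _, A, B, hκ, hAB⟩ := exists_rectangle_cover_card_le_two_pow_coNPcc (compose f g)
  have hpos : 0 < hits g z univ univ univ :=
    lt_of_lt_of_le (by positivity) (half_pow_le_hits_univ_of_disc_le z (by linarith) hn hg)
  obtain ⟨j, hj⟩ := exists_hits_univ_le_card_mul (A := A) (B := B) hpos fun x y hxy =>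
    (hAB x y).1 ((congrArg f (funext hxy)).trans hz)
  have hT : (1 : ℝ) ≤ Fintype.card κ := by exact_mod_cast Fintype.card_pos_iff.2 ⟨j⟩
  obtain ⟨I, hI, hcover⟩ := exists_forall_eq_of_hits_univ_le hp hn hT hg hj
  have hcert : IsCertificate f z I := fun z' hz' => by
    obtain ⟨x, hx, y, hy, hxy⟩ := hcover z' hz'
    rw [hz, ← funext hxy]
    exact (hAB x y).2 ⟨j, hx, hy⟩
  calc p ^ C₀ f ≤ p ^ #I := pow_le_pow_right₀ (by linarith) (hmin I hcert)
    _ ≤ Fintype.card κ := hI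
    _ ≤ 2 ^ coNPcc (compose f g) := by exact_mod_cast hκ

end Simulation

section Parameters

variable {η : ℝ} {ℓ n : ℕ}

lemma four_mul_le_two_rpow (hη : 0 < η) (hn : 2 ≤ n) (hℓ : 96 / η * Real.logb 2 n ≤ ℓ) :
    4 * (n : ℝ) ≤ 2 ^ (η * ℓ / 32) := by
  have hn' : (2 : ℝ) ≤ n := by exact_mod_cast hn
  have hlog : 3 * Real.logb 2 n ≤ η * ℓ / 32 := by
    rw [div_mul_eq_mul_div, div_le_iff₀ hη] at hℓ
    linarith
  calc 4 * (n : ℝ) ≤ n ^ 2 * n := by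
        gcongr
        nlinarith
    _ = n ^ 3 := by ring
    _ = 2 ^ (3 * Real.logb 2 n) := by
        rw [mul_comm, Real.rpow_mul zero_le_two, Real.rpow_logb two_pos (by norm_num)
          (by positivity)]
        norm_num
    _ ≤ 2 ^ (η * ℓ / 32) := Real.rpow_le_rpow_of_exponent_le one_le_two hlog

end Parameters

end Lifting

theorem mainTheorem3 :
    ∃ κ : ℝ, 0 < κ ∧
      ∀ η : ℝ, 0 < η → ∃ c : ℝ, 0 < c ∧
        ∀ ℓ n : ℕ, 2 ≤ n → c * Real.logb 2 (n : ℝ) ≤ (ℓ : ℝ) →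
          ∀ g : (Fin ℓ → Bool) → (Fin ℓ → Bool) → Bool,
            Lifting.disc g ≤ (2 : ℝ) ^ (-(η * (ℓ : ℝ))) →
              ∀ f : (Fin n → Bool) → Bool,
                κ * (η * (Lifting.C₀ f : ℝ) * (ℓ : ℝ)) ≤
                  (Lifting.coNPcc (Lifting.compose f g) : ℝ) := by
  refine ⟨1 / 32, by norm_num, fun η hη => ⟨96 / η, by positivity, ?_⟩⟩
  intro ℓ n hn hℓ g hg f
  set p : ℝ := 2 ^ (η * ℓ / 32) with p_def
  have hpow (k : ℕ) : p ^ k = 2 ^ (η * ℓ / 32 * k) := by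
    rw [p_def, Real.rpow_mul_natCast zero_le_two]
  have hnp : 4 * (n : ℝ) ≤ p := Lifting.four_mul_le_two_rpow hη hn hℓ
  have hp : 8 ≤ p := by linarith [show (2 : ℝ) ≤ n by exact_mod_cast hn]
  have hnp₄ : 16 * n ≤ p ^ 4 := by
    calc (16 : ℝ) * n ≤ 8 ^ 3 * p := by linarith
      _ ≤ p ^ 3 * p := by gcongr
      _ = p ^ 4 := by ring
  have hdisc : Lifting.disc g ≤ (p ^ 32)⁻¹ := by
    rw [hpow, ← Real.rpow_neg zero_le_two]
    convert hg using 2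
    push_cast
    ring
  have hlift := Lifting.pow_C₀_le_two_pow_coNPcc f hp hnp₄ hdisc
  rw [hpow, ← Real.rpow_natCast, Real.rpow_le_rpow_left_iff one_lt_two] at hlift
  linarith
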